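/- **Model.** The input is a finite simple undirected graph $G=(V,E)$ with $n$ vertices and diameter $D$, which is also the communication network. The vertices carry distinct identifiers from $\{0,\dots,n^{c}-1\}$ for a fixed constant $c$. All vertices run the same code. Initially a vertex knows only its own identifier and the identifiers of its neighbours. The computation proceeds in synchronous rounds; in each round every vertex may send a (possibly different) bit string of length $O(\log n)$ to each of its neighbours, toss any finite number of private independent fair coins, and compute locally without restriction (the CONGEST model). At the end every vertex halts and outputs which of its incident edges are taken into the solution. **Problem.** A graph is $k$-edge-connected if it remains connected after the removal of any at most $k-1$ edges. In unweighted 3-ECSS the input is a 3-edge-connected graph $G$, and the goal is to find a 3-edge-connected spanning subgraph of $G$ with as few edges as possible; $\mathrm{OPT}(G)$ denotes the minimum number of edges. **Theorem (threeECSS).** There is a randomized distributed algorithm for unweighted 3-ECSS in the CONGEST model with expected approximation ratio $O(\log n)$ and time complexity $O(D\log^3 n)$ rounds. That is: for every $c$ there are an algorithm and constants $B,C_1,C_2$ such that, on every 3-edge-connected graph $G$ with $n$ vertices and diameter $D$ and for every assignment of identifiers as above, all messages have at most $B\log_2 n$ bits; for all outcomes of the coins all vertices have halted after at most $C_1 D\log^3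 n$ rounds, and the output $H$ is a 3-edge-connected spanning subgraph of $G$; and $\mathbb{E}\,|E(H)|\le C_2\log n\cdot \mathrm{OPT}(G)$. -/

import Mathlib

open MeasureTheory

/-- A synchronous message-passing algorithm with private coins, run by every vertex of a network.
All vertices run the same code. Vertices are told apart only by their identifiers, which are
natural numbers, and local computation is unrestricted.

* `init i N` is the initial state of a vertex with identifier `i` whose neighbours have
  identifiers `N`; this is all that a vertex knows at the start.
* `send s j` is the bit string sent, in state `s`, to the neighbour with identifier `j`
  (the empty string means that nothing is sent).
* `coins s` is the number of fair coins tossed during a round that starts in state `s`.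
* `step s r b` is the next state, where `r j` is the string received from the neighbour with
  identifier `j` and `b` is the list of the outcomes of the coins tossed in this round.
* `output s` is `none` as long as the vertex is running, and `some S` once it has halted with
  the answer: the edges to the neighbours with identifiers in `S` are taken to the solution. -/
structure DistributedAlgorithm where
  State : Type
  init : ℕ → Finset ℕ → State
  send : State → ℕ → List Bool
  coins : State → ℕ
  step : State → (ℕ → List Bool) → List Bool → State
  output : State → Option (Finset ℕ)

/-- The outcomes of all coins: `ω (v, t, i)` is the `i`-th coin of the vertex `v` in round `t`. -/
abbrev CoinTosses (V : Type*) : Type _ := V × ℕ × ℕ → Bool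

/-- The law of independent fair coins. -/
noncomputable def fairCoins (V : Type*) : Measure (CoinTosses V) :=
  Measure.infinitePi fun _ => (PMF.uniformOfFintype Bool).toMeasure

instance (V : Type*) : IsProbabilityMeasure (fairCoins V) := by
  unfold fairCoins; infer_instance

namespace DistributedAlgorithm

variable {V : Type*} [Fintype V] (A : DistributedAlgorithm) (G : SimpleGraph V) (ids : V ↪ ℕ)

open Classical in
/-- The set of the identifiers of the neighbours of `v` in a graph. -/
noncomputable def neighborIds (v : V) : Finset ℕ :=
  (Finset.univ.filter (G.Adj v)).map ids

open Classical in
/-- The string that `u` sends to `v` when the vertices are in the states `s`. Only neighbours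
communicate, and a vertex that has halted is silent. -/
noncomputable def message (s : V → A.State) (u v : V) : List Bool :=
  if G.Adj u v ∧ A.output (s u) = none then A.send (s u) (ids v) else []

/-- What `v` receives when the vertices are in the states `s`: the strings sent to it, indexed by
the identifiers of their senders. -/
noncomputable def inbox (s : V → A.State) (v : V) : ℕ → List Bool :=
  Function.extend ids (fun u => A.message G ids s u v) fun _ => []

/-- The states of all vertices after `t` rounds. A vertex that has halted keeps its state. -/
noncomputable def run (ω : CoinTosses V) : ℕ → V → A.State
  | 0, v => A.init (ids v) (neighborIds G ids v)
  | t + 1, v =>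
    let s := run ω t
    match A.output (s v) with
    | none => A.step (s v) (A.inbox G ids s v)
        (List.ofFn fun i : Fin (A.coins (s v)) => ω (v, t, i))
    | some _ => s v

/-- In every execution, every message has at most `b` bits. -/
def MessagesBoundedBy (b : ℝ) : Prop :=
  ∀ (ω : CoinTosses V) (t : ℕ) (u v : V),
    ((A.message G ids (A.run G ids ω t) u v).length : ℝ) ≤ b

/-- After `t` rounds all vertices have halted, and every vertex has output its incident edges in
the graph `H`. -/
def HaltsWith (ω : CoinTosses V) (t : ℕ) (H : SimpleGraph V) : Prop :=
  ∀ v, A.output (A.run G ids ω t v) = some (neighborIds H ids v)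

end DistributedAlgorithm

/-- `H` is a `k`-edge-connected spanning subgraph of `G`. -/
def IsECSS {V : Type*} (k : ℕ) (G H : SimpleGraph V) : Prop :=
  H ≤ G ∧ H.IsEdgeConnected k

/-- The minimum number of edges of a `k`-edge-connected spanning subgraph of `G`. -/
noncomputable def minECSSSize {V : Type*} (k : ℕ) (G : SimpleGraph V) : ℕ :=
  sInf {m | ∃ H, IsECSS k G H ∧ H.edgeSet.ncard = m}

/-!
Since every spanning connected subgraph has at least `n - 1` edges, a solution with `O(n)` edges in
expectation is within the claimed approximation ratio. Such a solution is the union of three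
edge-disjoint connectivity certificates `F₀`, `F₁`, `F₂`, where `F_q` is a subgraph of `G` without
the edges of the earlier ones that has the same components. If at most two edges are removed, one of
the certificates stays intact, and it bridges every edge that is in none of them
(`isEdgeConnected_certificateUnion`).

A sparse certificate comes from random shifts. Every vertex `u` draws a geometric random variable
`r u`, truncated at `L ≈ log n`, and every vertex `v` joins the cluster of the vertex `u` that
maximizes `r u - dist u v`; this is found by flooding for `L` rounds. Then `v` picks one edge to
every adjacent cluster whose value at the neighbour is at least the value at `v`. Every cluster is
connected by picked edges, and every edge between clusters is bridged
(`certificate_reachable_of_adj`). If `v` picks an edge to the cluster of `u`, then `r u - dist u v`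
is within one of the maximum (`card_picks_le`). As the geometric distribution has no memory, two
more heads would make `u` the unique maximizer, so the expected number of such `u` is at most `4`,
plus a contribution of the truncation of at most `3 n / 2 ^ L`
(`sum_card_nearMaximizers_le`). The later certificates use fresh coins, and this count only needs
that the graph does not depend on them (`sum_card_certificateUnion_le`).

The vertices do not know `n`, and need a common `L`. They flood the largest identifier for
`k = 1, 2, 4, …` rounds; after each attempt a vertex that disagrees with a neighbour raises an
alarm, which is flooded for `2 * k` rounds. Either everybody agrees or everybody hears an alarm
(`flood_disagree_eq_zero_iff`), so the vertices stay synchronized, and they agree as soon as `k`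
reaches the diameter. The whole computation takes `O(D + log n)` rounds, and all messages are
numbers polynomial in `n`. The coins affect only which edges are taken.
-/

/-! ### Flooding with decay -/

section Flood

variable {V : Type*} [Fintype V]

open Classical in
/-- One round of flooding in `G`: every vertex takes the maximum of its own value and of the values
of its neighbours, each lowered by `δ` (and truncated at `0`). -/
noncomputable def flood (G : SimpleGraph V) (δ : ℕ) (x : V → ℕ) (v : V) : ℕ :=
  max (x v) ((Finset.univ.filter (G.Adj v)).sup fun u => x u - δ)

theorem le_flood_self (G : SimpleGraph V) (δ : ℕ) (x : V → ℕ) (v : V) : x v ≤ flood G δ x v :=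
  le_max_left _ _

theorem sub_le_flood {G : SimpleGraph V} (δ : ℕ) (x : V → ℕ) {v u : V} (h : G.Adj v u) :
    x u - δ ≤ flood G δ x v := by
  classical
  refine le_max_of_le_right (Finset.le_sup (f := fun u => x u - δ) ?_)
  simpa using h

theorem flood_eq_or (G : SimpleGraph V) (δ : ℕ) (x : V → ℕ) (v : V) :
    flood G δ x v = x v ∨ ∃ u, G.Adj v u ∧ flood G δ x v = x u - δ := by
  classical
  rcases (Finset.univ.filter (G.Adj v)).eq_empty_or_nonempty with h | h
  · left
    simp [flood, h]
  · obtain ⟨u, hu, hmax⟩ := Finset.exists_mem_eq_sup _ h (fun u => x u - δ)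
    rcases max_choice (x v) ((Finset.univ.filter (G.Adj v)).sup fun u => x u - δ) with h' | h'
    · exact Or.inl h'
    · exact Or.inr ⟨u, by simpa using hu, h'.trans hmax⟩

theorem sub_le_flood_iterate {G : SimpleGraph V} (δ : ℕ) (x : V → ℕ) {v u : V} (p : G.Walk v u)
    {t : ℕ} (ht : p.length ≤ t) : x u - p.length * δ ≤ (flood G δ)^[t] x v := by
  induction p generalizing t with
  | nil =>
    induction t with
    | zero => simp
    | succ t ih =>
      rw [Function.iterate_succ_apply']
      exact (ih (by simp)).trans (le_flood_self _ _ _ _)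
  | cons h p ih =>
    obtain ⟨t, rfl⟩ : ∃ s, t = s + 1 := ⟨t - 1, by simp at ht; omega⟩
    rw [Function.iterate_succ_apply']
    have h1 := ih (t := t) (by simpa using ht)
    have h2 := sub_le_flood δ ((flood G δ)^[t] x) h
    simp only [SimpleGraph.Walk.length_cons, add_mul, one_mul]
    omega

theorem exists_walk_flood_iterate (G : SimpleGraph V) (δ : ℕ) (x : V → ℕ) (t : ℕ) (v : V) :
    ∃ u, ∃ p : G.Walk v u, p.length ≤ t ∧ (flood G δ)^[t] x v = x u - p.length * δ := by
  induction t generalizing v with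
  | zero => exact ⟨v, .nil, by simp, by simp⟩
  | succ t ih =>
    rw [Function.iterate_succ_apply']
    rcases flood_eq_or G δ ((flood G δ)^[t] x) v with h | ⟨w, hw, h⟩
    · obtain ⟨u, p, hp, hx⟩ := ih v
      exact ⟨u, p, by omega, h.trans hx⟩
    · obtain ⟨u, p, hp, hx⟩ := ih w
      refine ⟨u, .cons hw p, by simpa using hp, ?_⟩
      rw [h, hx, SimpleGraph.Walk.length_cons, add_mul]
      omega

theorem flood_iterate_le {G : SimpleGraph V} {δ : ℕ} {x : V → ℕ} {b : ℕ} (h : ∀ v, x v ≤ b) (t : ℕ)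
    (v : V) : (flood G δ)^[t] x v ≤ b := by
  obtain ⟨u, p, -, hx⟩ := exists_walk_flood_iterate G δ x t v
  rw [hx]
  exact (Nat.sub_le _ _).trans (h u)

/-! ### Detecting that flooding is complete -/

open Classical in
/-- The indicator of the vertices that have a neighbour with a different value. -/
noncomputable def disagree (G : SimpleGraph V) (M : V → ℕ) (v : V) : ℕ :=
  if ∃ u, G.Adj v u ∧ M u ≠ M v then 1 else 0

theorem disagree_le_one (G : SimpleGraph V) (M : V → ℕ) (v : V) : disagree G M v ≤ 1 := by
  unfold disagree
  split_ifs <;> simp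

/-- If flooding an injective labelling for `k` rounds has not yet produced a constant function, then
every vertex is within distance `2 * k` of a disagreement. Indeed the vertices that hold the same
label as `v` all lie within distance `k` of the owner of that label, and if none of them saw a
disagreement, then they would form a component. -/
theorem flood_disagree_eq_zero_iff {G : SimpleGraph V} (hG : G.Connected) {x : V → ℕ}
    (hx : Function.Injective x) (k : ℕ) (v : V) :
    (flood G 0)^[2 * k] (disagree G ((flood G 0)^[k] x)) v = 0 ↔
      ∀ u w, (flood G 0)^[k] x u = (flood G 0)^[k] x w := by
  set M := (flood G 0)^[k] x with hM
  constructor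
  · intro h
    obtain ⟨c, p, hp, hc⟩ := exists_walk_flood_iterate G 0 x k v
    have key : ∀ u, M u = M v → disagree G M u = 0 := by
      intro u hu
      obtain ⟨c', p', hp', hc'⟩ := exists_walk_flood_iterate G 0 x k u
      have : c' = c := hx (by
        simp only [mul_zero, Nat.sub_zero] at hc hc'
        rw [← hc, ← hc']
        exact hu)
      subst this
      have := sub_le_flood_iterate 0 (disagree G M) (p.append p'.reverse) (t := 2 * k)
        (by simp; omega)
      rw [h] at this
      simpa using this
    have step : ∀ u w, G.Adj u w → M u = M v → M w = M v := by
      intro u w hadj hu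
      have h0 := key u hu
      unfold disagree at h0
      by_contra hne
      rw [if_pos ⟨w, hadj, fun h => hne (h.trans hu)⟩] at h0
      simp at h0
    have walk : ∀ a b, G.Walk a b → M a = M v → M b = M v := by
      intro a b q
      induction q with
      | nil => exact id
      | cons hadj q ih => exact fun ha => ih (step _ _ hadj ha)
    have all : ∀ u, M u = M v := fun u => by
      obtain ⟨q⟩ := hG.preconnected v u
      exact walk v u q rfl
    intro u w
    rw [all u, all w]
  · intro h
    have h0 : ∀ u, disagree G M u ≤ 0 := by
      intro u
      unfold disagree
      rw [if_neg]
      rintro ⟨w, -, hw⟩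
      exact hw (h _ _)
    exact Nat.le_zero.mp (flood_iterate_le h0 _ _)

theorem flood_iterate_eq_of_diam_le {G : SimpleGraph V} (hG : G.Connected) (x : V → ℕ) {k : ℕ}
    (hk : G.diam ≤ k) (u w : V) : (flood G 0)^[k] x u = (flood G 0)^[k] x w := by
  have : Nonempty V := ⟨u⟩
  have le : ∀ u w, (flood G 0)^[k] x u ≤ (flood G 0)^[k] x w := by
    intro u w
    obtain ⟨c, p, -, hc⟩ := exists_walk_flood_iterate G 0 x k u
    obtain ⟨q, hq⟩ := hG.exists_walk_length_eq_dist w c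
    have hd : G.dist w c ≤ G.diam :=
      SimpleGraph.dist_le_diam (SimpleGraph.connected_iff_ediam_ne_top.mp hG)
    have := sub_le_flood_iterate 0 x q (t := k) (by omega)
    rw [hc]
    simpa using this
  exact le_antisymm (le u w) (le w u)

theorem le_of_flood_iterate_const {G : SimpleGraph V} {x : V → ℕ} {k : ℕ}
    (h : ∀ u w, (flood G 0)^[k] x u = (flood G 0)^[k] x w) (u v : V) :
    x u ≤ (flood G 0)^[k] x v := by
  rw [h v u]
  simpa using sub_le_flood_iterate 0 x (SimpleGraph.Walk.nil : G.Walk u u) (t := k) (by simp)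

end Flood

/-! ### Sparse connectivity certificates from random shifts -/

section Certificate

variable {V : Type*} [Fintype V] (ids : V ↪ ℕ) (K L : ℕ)

/-- The number `r v * K + ids v`, which encodes the pair of a shift and an identifier below `K`;
lowering it by `K` lowers the shift by one. -/
def initialKey (r : V → ℕ) (v : V) : ℕ := r v * K + ids v

/-- The key of `v` encodes the lexicographically largest pair `(r u - d, ids u)` over the vertices
`u` at distance `d` from `v`. The vertex `u` where it is attained is the *center* of `v`. -/
noncomputable def finalKey (G : SimpleGraph V) (r : V → ℕ) : V → ℕ :=
  (flood G K)^[L] (initialKey ids K r)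

open Classical in
/-- The neighbours that `v` picks when all vertices hold the given keys: one of every adjacent
cluster whose value at that neighbour is at least the value at `v`. Among the neighbours in a
cluster, the one with the largest key is preferred, and then the one with the smallest
identifier. -/
noncomputable def picks (G : SimpleGraph V) (key : V → ℕ) (v : V) : Finset V :=
  Finset.univ.filter fun u => G.Adj v u ∧ key v / K ≤ key u / K ∧
    ∀ w, G.Adj v w → key w % K = key u % K →
      key w < key u ∨ key w = key u ∧ ids u ≤ ids w

/-- The graph of all edges picked by one of their ends. -/
noncomputable def certificate (G : SimpleGraph V) (r : V → ℕ) : SimpleGraph V :=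
  SimpleGraph.fromRel fun v u => u ∈ picks ids K G (finalKey ids K L G r) v

variable {ids K L} {G : SimpleGraph V} {r : V → ℕ}

theorem adj_of_mem_picks {key : V → ℕ} {v u : V} (h : u ∈ picks ids K G key v) : G.Adj v u := by
  classical
  exact (Finset.mem_filter.mp h).2.1

theorem certificate_le : certificate ids K L G r ≤ G := by
  intro v u h
  rcases h.2 with h | h
  · exact adj_of_mem_picks h
  · exact (adj_of_mem_picks h).symm

theorem certificate_adj_of_mem_picks {v u : V} (h : u ∈ picks ids K G (finalKey ids K L G r) v) :
    (certificate ids K L G r).Adj v u :=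
  ⟨(adj_of_mem_picks h).ne, Or.inl h⟩

theorem exists_mem_picks (key : V → ℕ) {v u : V} (hadj : G.Adj v u)
    (hle : key v / K ≤ key u / K) :
    ∃ w ∈ picks ids K G key v, key w % K = key u % K ∧ key u ≤ key w := by
  classical
  set S := Finset.univ.filter fun w => G.Adj v w ∧ key w % K = key u % K with hS
  have hu : u ∈ S := by simp [hS, hadj]
  obtain ⟨w, hw, hmax⟩ := S.exists_max_image key ⟨u, hu⟩
  obtain ⟨z, hz, hmin⟩ := (S.filter fun z => key z = key w).exists_min_image ids ⟨w, by simp [hw]⟩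
  have hzS := (Finset.mem_filter.mp hz).1
  have hzw := (Finset.mem_filter.mp hz).2
  have hz' : G.Adj v z ∧ key z % K = key u % K := by simpa [hS] using hzS
  have huz : key u ≤ key z := hzw ▸ hmax u hu
  refine ⟨z, ?_, hz'.2, huz⟩
  simp only [picks, Finset.mem_filter, Finset.mem_univ, true_and]
  refine ⟨hz'.1, hle.trans (Nat.div_le_div_right huz), fun y hy hyc => ?_⟩
  have hyS : y ∈ S := by simp [hS, hy, hyc, hz'.2]
  rcases (hmax y hyS).lt_or_eq with h | h
  · left; omega
  · right
    exact ⟨by omega, hmin y (by simp [hyS, h])⟩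

/-- Keys are the pairs `(r u - d, ids u)`, with `d` the length of a walk to `u`. -/
theorem exists_walk_finalKey (hK : ∀ v, ids v < K) (v : V) (t : ℕ) :
    ∃ u, ∃ p : G.Walk v u, p.length ≤ r u ∧
      (flood G K)^[t] (initialKey ids K r) v = (r u - p.length) * K + ids u := by
  obtain ⟨u, p, hp, hx⟩ := exists_walk_flood_iterate G K (initialKey ids K r) t v
  by_cases h : p.length ≤ r u
  · refine ⟨u, p, h, hx.trans ?_⟩
    obtain ⟨m, hm⟩ := Nat.exists_eq_add_of_le h
    simp only [initialKey, hm, add_mul]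
    rw [Nat.add_sub_cancel_left]
    omega
  · -- The truncated difference is `0`, which bounds the initial key of `v` as well.
    have h0 : initialKey ids K r u - p.length * K = 0 := by
      have := hK u
      have h2 : (r u + 1) * K ≤ p.length * K := Nat.mul_le_mul_right _ (by omega)
      simp only [initialKey]
      rw [add_mul] at h2
      omega
    have h1 := sub_le_flood_iterate K (initialKey ids K r) (SimpleGraph.Walk.nil : G.Walk v v)
      (t := t) (by simp)
    rw [hx, h0] at h1
    refine ⟨v, .nil, by simp, ?_⟩
    rw [hx, h0]
    simp only [SimpleGraph.Walk.length_nil, zero_mul, Nat.sub_zero, initialKey] at h1 ⊢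
    omega

theorem le_finalKey (hL : ∀ v, r v ≤ L) {v u : V} (p : G.Walk v u) :
    r u * K + ids u - p.length * K ≤ finalKey ids K L G r v ∨ r u < p.length := by
  by_cases h : p.length ≤ L
  · exact Or.inl (sub_le_flood_iterate K (initialKey ids K r) p h)
  · exact Or.inr ((hL u).trans_lt (by omega))

theorem sub_le_finalKey_div (hL : ∀ v, r v ≤ L) (hK : 0 < K) {v u : V} (p : G.Walk v u) :
    r u - p.length ≤ finalKey ids K L G r v / K := by
  rcases le_finalKey (ids := ids) (K := K) hL p with h | h
  · rw [Nat.le_div_iff_mul_le hK, Nat.sub_mul]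
    omega
  · rw [Nat.sub_eq_zero_of_le h.le]
    exact Nat.zero_le _

/-- After `L` rounds the keys are stable. -/
theorem finalKey_stable (hL : ∀ v, r v ≤ L) (hK : ∀ v, ids v < K) :
    flood G K (finalKey ids K L G r) = finalKey ids K L G r := by
  funext v
  refine le_antisymm ?_ (le_flood_self _ _ _ _)
  rw [finalKey, ← Function.iterate_succ_apply' (flood G K)]
  obtain ⟨u, p, hp, hx⟩ := exists_walk_finalKey (G := G) (r := r) hK v (L + 1)
  rw [hx]
  have := le_finalKey (ids := ids) (K := K) hL p
  obtain ⟨m, hm⟩ := Nat.exists_eq_add_of_le hp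
  rw [hm, add_mul] at this
  rw [hm, Nat.add_sub_cancel_left]
  simp only [finalKey] at this
  omega

theorem finalKey_lt (hL : ∀ v, r v ≤ L) (hK : ∀ v, ids v < K) (t : ℕ) (v : V) :
    (flood G K)^[t] (initialKey ids K r) v < (L + 1) * K := by
  obtain ⟨u, p, hp, hx⟩ := exists_walk_finalKey (G := G) (r := r) hK v t
  have h1 : (r u - p.length) * K ≤ L * K := Nat.mul_le_mul_right _ ((Nat.sub_le _ _).trans (hL u))
  have := hK u
  rw [hx, add_mul]
  omega

/-- Every vertex is joined to its center in the certificate: following picked neighbours of the same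
center, the keys grow until the center is reached. -/
theorem certificate_reachable_center (hL : ∀ v, r v ≤ L) (hK : ∀ v, ids v < K) (v : V) :
    ∃ u, ids u = finalKey ids K L G r v % K ∧ (certificate ids K L G r).Reachable v u := by
  set key := finalKey ids K L G r with hkey
  have hpos : 0 < K := (Nat.zero_le _).trans_lt (hK v)
  induction hn : (L + 1) * K - key v using Nat.strong_induction_on generalizing v with
  | _ n ih =>
  by_cases hown : key v = initialKey ids K r v
  · refine ⟨v, ?_, .rfl⟩
    rw [hown, initialKey, Nat.mul_add_mod', Nat.mod_eq_of_lt (hK v)]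
  · -- The key came along a walk through a neighbour, whose key is larger by `K`.
    obtain ⟨y, hy, hyk⟩ : ∃ y, G.Adj v y ∧ key y = key v + K := by
      obtain ⟨u, p, hp, hx⟩ := exists_walk_finalKey (G := G) (r := r) hK v L
      change key v = _ at hx
      cases p with
      | nil => exact absurd (by simpa [initialKey] using hx) hown
      | @cons _ y _ h q =>
        refine ⟨y, h, ?_⟩
        have h1 := sub_le_flood K key h
        rw [hkey, finalKey_stable hL hK, ← hkey] at h1
        rw [SimpleGraph.Walk.length_cons] at hp hx
        have h2 := le_finalKey (ids := ids) (K := K) hL q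
        change _ ≤ key y ∨ _ at h2
        obtain ⟨m, hm⟩ := Nat.exists_eq_add_of_le hp
        rw [hm, Nat.add_sub_cancel_left] at hx
        rw [hm, add_mul, add_mul] at h2
        omega
    obtain ⟨w, hw, hwc, hwy⟩ := exists_mem_picks (ids := ids) (K := K) key hy
      (Nat.div_le_div_right (by omega))
    have hlt := finalKey_lt (G := G) hL hK L w
    change key w < _ at hlt
    obtain ⟨u, hu, hr⟩ := ih _ (by omega) w rfl
    refine ⟨u, ?_, (certificate_adj_of_mem_picks hw).reachable.trans hr⟩
    rw [hu, hwc, hyk, Nat.add_mod_right]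

theorem certificate_reachable_of_adj (hL : ∀ v, r v ≤ L) (hK : ∀ v, ids v < K) {v u : V}
    (h : G.Adj v u) : (certificate ids K L G r).Reachable v u := by
  set key := finalKey ids K L G r with hkey
  wlog hle : key v / K ≤ key u / K generalizing v u
  · exact (this h.symm (by omega)).symm
  obtain ⟨w, hw, hwc, -⟩ := exists_mem_picks (ids := ids) (K := K) key h hle
  obtain ⟨a, ha, hwa⟩ := certificate_reachable_center (G := G) hL hK w
  obtain ⟨b, hb, hub⟩ := certificate_reachable_center (G := G) hL hK u
  obtain rfl : a = b := ids.injective (by rw [ha, hb]; exact hwc)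
  exact ((certificate_adj_of_mem_picks hw).reachable.trans hwa).trans hub.symm

open Classical in
/-- The vertices whose shifted distance to `v` is at most one away from the best, where `d` are the
distances to the vertices of `W`. -/
noncomputable def nearMaximizers (W : Finset V) (d r : V → ℕ) : Finset V :=
  W.filter fun u => ∀ w ∈ W, r w + d u ≤ r u + d w + 1

/-- Different picks of `v` have different centers, and these are all almost best for `v`. -/
theorem card_picks_le [DecidableRel G.Reachable] (hL : ∀ v, r v ≤ L) (hK : ∀ v, ids v < K) (v : V) :
    (picks ids K G (finalKey ids K L G r) v).card ≤
      (nearMaximizers (Finset.univ.filter (G.Reachable v)) (G.dist v) r).card := by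
  set key := finalKey ids K L G r with hkey
  have hpos : 0 < K := (Nat.zero_le _).trans_lt (hK v)
  choose c p hp hc using fun v => exists_walk_finalKey (G := G) (r := r) hK v L
  refine Finset.card_le_card_of_injOn c ?_ ?_
  · intro u hu
    have hu' := hu
    simp only [picks, Finset.coe_filter, Finset.mem_univ, true_and, Set.mem_ofPred_eq] at hu'
    obtain ⟨hadj, hle, -⟩ := hu'
    have hdiv : key u / K = r (c u) - (p u).length := by
      rw [hkey, finalKey, hc u, mul_comm, Nat.mul_add_div hpos, Nat.div_eq_of_lt (hK _), add_zero]
    have hd : G.dist v (c u) ≤ (p u).length + 1 := by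
      simpa using SimpleGraph.dist_le (SimpleGraph.Walk.cons hadj (p u))
    simp only [nearMaximizers, Finset.coe_filter, Finset.mem_filter, Finset.mem_univ, true_and,
      Set.mem_ofPred_eq]
    refine ⟨⟨SimpleGraph.Walk.cons hadj (p u)⟩, fun w hw => ?_⟩
    obtain ⟨q, hq⟩ := hw.exists_walk_length_eq_dist
    have h1 := sub_le_finalKey_div (ids := ids) hL hpos q
    change _ ≤ key v / K at h1
    have h2 := hp u
    have h3 : r w - q.length ≤ r (c u) - (p u).length := h1.trans (hle.trans hdiv.le)
    omega
  · intro u hu w hw huw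
    simp only [picks, Finset.coe_filter, Finset.mem_univ, true_and, Set.mem_ofPred_eq] at hu hw
    have hmod : ∀ u, key u % K = ids (c u) := fun u => by
      rw [hkey, finalKey, hc u, Nat.mul_add_mod', Nat.mod_eq_of_lt (hK _)]
    have h1 := hu.2.2 w hw.1 (by rw [hmod, hmod, huw])
    have h2 := hw.2.2 u hu.1 (by rw [hmod, hmod, huw])
    exact ids.injective (by omega)

theorem card_edgeSet_certificate_le :
    (certificate ids K L G r).edgeSet.ncard ≤
      ∑ v, (picks ids K G (finalKey ids K L G r) v).card := by
  classical
  set P := picks ids K G (finalKey ids K L G r)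
  rw [← Finset.card_sigma]
  have hsub : (certificate ids K L G r).edgeSet ⊆
      (((Finset.univ.sigma P).image fun a => s(a.1, a.2) : Finset (Sym2 V)) : Set (Sym2 V)) := by
    intro e
    induction e with
    | _ v u =>
    intro h
    simp only [Finset.coe_image, Set.mem_image]
    rcases h.2 with h | h
    · exact ⟨⟨v, u⟩, by simpa using h, rfl⟩
    · exact ⟨⟨u, v⟩, by simpa using h, Sym2.eq_swap⟩
  calc _ ≤ _ := Set.ncard_le_ncard hsub (Finset.finite_toSet _)
    _ ≤ _ := by rw [Set.ncard_coe_finset]; exact Finset.card_image_le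

end Certificate

/-! ### Unions of edge-disjoint certificates -/

section Union

variable {V : Type*} [Fintype V] (ids : V ↪ ℕ) (K L : ℕ) (G : SimpleGraph V)

/-- The union of the first `q` certificates, each of which is taken in the graph of the edges that
are not in the previous ones; `r q` are the shifts for the `q`-th. -/
noncomputable def certificateUnion (r : ℕ → V → ℕ) : ℕ → SimpleGraph V
  | 0 => ⊥
  | q + 1 => certificateUnion r q ⊔ certificate ids K L (G \ certificateUnion r q) (r q)

variable {ids K L G} {r : ℕ → V → ℕ}

theorem certificateUnion_congr {r' : ℕ → V → ℕ} {q : ℕ} (h : ∀ p < q, r p = r' p) :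
    certificateUnion ids K L G r q = certificateUnion ids K L G r' q := by
  induction q with
  | zero => rfl
  | succ q ih => simp only [certificateUnion, ih fun p hp => h p (hp.trans q.lt_succ_self),
      h q q.lt_succ_self]

theorem certificateUnion_mono : Monotone (certificateUnion ids K L G r) :=
  monotone_nat_of_le_succ fun _ => le_sup_left

theorem certificateUnion_le (q : ℕ) : certificateUnion ids K L G r q ≤ G := by
  induction q with
  | zero => exact bot_le
  | succ q ih => exact sup_le ih (certificate_le.trans sdiff_le)

/-- If fewer than `k` edges are removed, one of `k` edge-disjoint certificates stays intact, and it
bridges every edge that is in none of them. -/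
theorem isEdgeConnected_certificateUnion (hL : ∀ q v, r q v ≤ L) (hK : ∀ v, ids v < K) {k : ℕ}
    (hG : G.IsEdgeConnected k) : (certificateUnion ids K L G r k).IsEdgeConnected k := by
  intro u v s hs
  set H := certificateUnion ids K L G r with hH
  obtain ⟨q, hq, hdisj⟩ : ∃ q < k, ∀ e ∈ s,
      e ∉ (certificate ids K L (G \ H q) (r q)).edgeSet := by
    by_contra! hcon
    have : Nonempty (Sym2 V) := ⟨s(u, v)⟩
    choose! e he using hcon
    have hlt : ∀ p q, p < q → q < k → e p ≠ e q := by
      intro p q hpq hq heq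
      have h1 : e q ∈ (H (p + 1)).edgeSet := by
        rw [← heq]
        exact SimpleGraph.edgeSet_mono (le_sup_right) (he p (hpq.trans hq)).2
      have h2 := SimpleGraph.edgeSet_mono (certificateUnion_mono (r := r) (ids := ids) (K := K)
        (L := L) (G := G) (Nat.succ_le_of_lt hpq)) h1
      have h3 := SimpleGraph.edgeSet_mono certificate_le (he q hq).2
      rw [SimpleGraph.edgeSet_sdiff] at h3
      exact h3.2 h2
    have hinj : Set.InjOn e (Finset.range k : Set ℕ) := by
      intro p hp q hq heq
      simp only [Finset.coe_range, Set.mem_Iio] at hp hq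
      by_contra hne
      rcases lt_or_gt_of_ne hne with h | h
      · exact hlt p q h hq heq
      · exact hlt q p h hp heq.symm
    have hle : (e '' (Finset.range k : Set ℕ)).encard ≤ s.encard := by
      refine Set.encard_le_encard ?_
      rintro _ ⟨p, hp, rfl⟩
      exact (he p (by simpa using hp)).1
    rw [hinj.encard_image, Set.encard_coe_eq_coe_finsetCard, Finset.card_range] at hle
    exact absurd hs (not_lt.mpr hle)
  obtain ⟨p⟩ := hG u v hs
  induction p with
  | nil => exact .rfl
  | @cons a b _ h p ih =>
    refine SimpleGraph.Reachable.trans ?_ ih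
    rw [SimpleGraph.deleteEdges_adj] at h
    by_cases hin : (H k).Adj a b
    · exact SimpleGraph.Adj.reachable (by rw [SimpleGraph.deleteEdges_adj]; exact ⟨hin, h.2⟩)
    · refine (certificate_reachable_of_adj (G := G \ H q) (r := r q) (hL q) hK
        ⟨h.1, fun h' => hin (certificateUnion_mono hq.le h')⟩).mono ?_
      intro a b hab
      rw [SimpleGraph.deleteEdges_adj]
      refine ⟨?_, fun hmem => hdisj _ hmem hab⟩
      have : H (q + 1) ≤ H k := certificateUnion_mono hq
      exact this (Or.inr hab)

theorem card_edgeSet_certificateUnion_le (q : ℕ) :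
    (certificateUnion ids K L G r q).edgeSet.ncard ≤ ∑ p ∈ Finset.range q,
      (certificate ids K L (G \ certificateUnion ids K L G r p) (r p)).edgeSet.ncard := by
  classical
  induction q with
  | zero => simp [certificateUnion]
  | succ q ih =>
    rw [Finset.sum_range_succ, certificateUnion, SimpleGraph.edgeSet_sup]
    exact (Set.ncard_union_le _ _).trans (by omega)

end Union

/-! ### Counting outcomes of coin tosses -/

section Counting

/-- The number of heads at the beginning of a list of coin tosses. -/
def leadingHeads : List Bool → ℕ
  | true :: l => leadingHeads l + 1
  | _ => 0

theorem le_leadingHeads_iff {k : ℕ} {l : List Bool} :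
    k ≤ leadingHeads l ↔ ∀ i < k, l[i]? = some true := by
  induction l generalizing k with
  | nil =>
    rcases k with _ | k
    · simp
    · simpa [leadingHeads] using ⟨0, by simp⟩
  | cons b l ih =>
    rcases k with _ | k
    · simp
    · cases b with
      | false => simpa [leadingHeads] using ⟨0, by simp⟩
      | true =>
        simp only [leadingHeads, Nat.add_le_add_iff_right, ih]
        constructor
        · rintro h (_ | i) hi
          · rfl
          · simpa using h i (by omega)
        · intro h i hi
          simpa using h (i + 1) (by omega)

theorem leadingHeads_le_length (l : List Bool) : leadingHeads l ≤ l.length := by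
  by_contra! h
  have := le_leadingHeads_iff.mp h l.length (Nat.lt_succ_self _)
  simp at this

variable {S : Type*} {L : ℕ}

/-- The number of leading heads among the `L` coins with the first index `s`; for fair coins, this
is a geometric random variable truncated at `L`. -/
def headRun (b : S × Fin L → Bool) (s : S) : ℕ :=
  leadingHeads (List.ofFn fun i => b (s, i))

theorem headRun_le (b : S × Fin L → Bool) (s : S) : headRun b s ≤ L := by
  simpa [headRun] using leadingHeads_le_length (List.ofFn fun i => b (s, i))

theorem le_headRun_iff {b : S × Fin L → Bool} {s : S} {k : ℕ} (hk : k ≤ L) :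
    k ≤ headRun b s ↔ ∀ i : Fin L, (i : ℕ) < k → b (s, i) = true := by
  rw [headRun, le_leadingHeads_iff]
  constructor
  · intro h i hi
    simpa using h i hi
  · intro h i hi
    simpa [show i < L by omega] using h ⟨i, by omega⟩ hi

variable [Fintype S] [DecidableEq S]

/-- The coin after the first `j` heads is heads again with probability `1/2`, also when the
threshold `j` is random, provided that it does not depend on these coins. -/
theorem card_le_headRun_le (s : S) (j : (S × Fin L → Bool) → ℕ)
    (hj : ∀ b i a, j (Function.update b (s, i) a) = j b) :
    (Finset.univ.filter fun b => j b ≤ headRun b s).card ≤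
      2 * (Finset.univ.filter fun b => j b + 1 ≤ headRun b s).card +
        (Finset.univ.filter fun b : S × Fin L → Bool => L ≤ headRun b s).card := by
  have hsplit : (Finset.univ.filter fun b => j b ≤ headRun b s) ⊆
      (Finset.univ.filter fun b => j b ≤ headRun b s ∧ j b < L) ∪
        (Finset.univ.filter fun b : S × Fin L → Bool => L ≤ headRun b s) := by
    intro b hb
    simp only [Finset.mem_union, Finset.mem_filter, Finset.mem_univ, true_and] at hb ⊢
    omega
  refine (Finset.card_le_card hsplit).trans ((Finset.card_union_le _ _).trans
    (Nat.add_le_add_right ?_ _))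
  -- Setting the coin number `j b` to heads is a map with fibres of size at most two.
  let f : (S × Fin L → Bool) → S × Fin L → Bool := fun b =>
    if h : j b < L then Function.update b (s, ⟨j b, h⟩) true else b
  refine Finset.card_le_mul_card_image_of_maps_to (f := f) ?_ 2 ?_
  · intro b hb
    simp only [Finset.mem_filter, Finset.mem_univ, true_and] at hb ⊢
    obtain ⟨h1, h2⟩ := hb
    simp only [f, dif_pos h2, hj]
    rw [le_headRun_iff h2]
    rw [le_headRun_iff h2.le] at h1
    intro i hi
    by_cases hij : i = ⟨j b, h2⟩
    · simp [hij]
    · rw [Function.update_of_ne (by simpa using hij)]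
      refine h1 i ?_
      have : (i : ℕ) ≠ j b := fun h => hij (Fin.ext h)
      omega
  · intro c hc
    by_cases h : j c < L
    · refine (Finset.card_le_card (t := {c, Function.update c (s, ⟨j c, h⟩) false}) ?_).trans
        Finset.card_le_two
      intro b hb
      simp only [Finset.mem_filter, Finset.mem_univ, true_and] at hb
      obtain ⟨⟨-, h2⟩, hbc⟩ := hb
      simp only [f, dif_pos h2] at hbc
      have hjc : j c = j b := by rw [← hbc, hj]
      simp only [Finset.mem_insert, Finset.mem_singleton]
      have hb' : b = Function.update c (s, ⟨j c, h⟩) (b (s, ⟨j b, h2⟩)) := by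
        simp only [hjc]
        simp [← hbc]
      cases hv : b (s, ⟨j b, h2⟩) with
      | false => right; rw [hb', hv]
      | true =>
        left
        rw [← hbc, ← hv, Function.update_eq_self]
    · rw [Finset.card_eq_zero.mpr]
      · exact Nat.zero_le _
      · refine Finset.filter_eq_empty_iff.mpr ?_
        intro b hb hbc
        simp only [Finset.mem_filter, Finset.mem_univ, true_and] at hb
        simp only [f, dif_pos hb.2] at hbc
        exact h (by rw [← hbc, hj]; exact hb.2)

theorem two_pow_mul_card_headRun_eq_le (s : S) :
    2 ^ L * (Finset.univ.filter fun b : S × Fin L → Bool => L ≤ headRun b s).card ≤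
      Fintype.card (S × Fin L → Bool) := by
  set E := Finset.univ.filter fun b : S × Fin L → Bool => L ≤ headRun b s
  have hE : ∀ b ∈ E, ∀ i, b (s, i) = true := by
    intro b hb i
    exact (le_headRun_iff le_rfl).mp (Finset.mem_filter.mp hb).2 i i.2
  -- All outcomes of the coins of `s` can be substituted for the heads.
  have : ((Finset.univ : Finset (Fin L → Bool)) ×ˢ E).card ≤
      (Finset.univ : Finset (S × Fin L → Bool)).card := by
    refine Finset.card_le_card_of_injOn
      (fun p x => if x.1 = s then p.1 x.2 else p.2 x) (fun _ _ => by simp) ?_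
    rintro ⟨c, b⟩ hb ⟨c', b'⟩ hb' heq
    simp only [Finset.coe_product, Set.mem_prod, Finset.mem_coe] at hb hb'
    have hval := fun x => congrFun heq x
    simp only at hval
    refine Prod.ext ?_ ?_
    · funext i
      simpa using hval (s, i)
    · funext x
      rcases x with ⟨t, i⟩
      by_cases ht : t = s
      · subst ht
        change b (t, i) = b' (t, i)
        rw [hE b hb.2, hE b' hb'.2]
      · simpa [ht] using hval (t, i)
  simpa [Finset.card_product] using this

/-- On average over the coins, at most seven vertices are almost best. If `u` is almost best, then
with probability at least `1/4` its next two coins would make it the unique best one, unless it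
reaches the truncation. -/
theorem sum_card_nearMaximizers_le {V : Type*} [Fintype V] (σ : V ↪ S)
    (W : (S × Fin L → Bool) → Finset V) (d : (S × Fin L → Bool) → V → ℕ)
    (hW : ∀ b u i a, W (Function.update b (σ u, i) a) = W b)
    (hd : ∀ b u i a, d (Function.update b (σ u, i) a) = d b) (hL : Fintype.card V ≤ 2 ^ L) :
    ∑ b, (nearMaximizers (W b) (d b) fun u => headRun b (σ u)).card ≤
      7 * Fintype.card (S × Fin L → Bool) := by
  classical
  -- `u` is almost best exactly if its run reaches the threshold `j u`.
  let j : V → (S × Fin L → Bool) → ℕ := fun u b => if u ∈ W b then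
    (((W b).erase u).sup fun w => headRun b (σ w) + d b u - (d b w + 1)) else L + 1
  have hrun : ∀ (b : S × Fin L → Bool) u w i a, w ≠ u →
      headRun (Function.update b (σ u, i) a) (σ w) = headRun b (σ w) := by
    intro b u w i a hwu
    unfold headRun
    congr 2
    funext k
    rw [Function.update_of_ne]
    simp [hwu]
  have hj : ∀ u b i a, j u (Function.update b (σ u, i) a) = j u b := by
    intro u b i a
    simp only [j, hW, hd]
    congr 1
    refine Finset.sup_congr rfl fun w hw => ?_
    rw [hrun _ _ _ _ _ (Finset.ne_of_mem_erase hw)]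
  have hnear : ∀ b u, u ∈ nearMaximizers (W b) (d b) (fun u => headRun b (σ u)) →
      j u b ≤ headRun b (σ u) := by
    intro b u hu
    obtain ⟨hu, h⟩ := Finset.mem_filter.mp hu
    simp only [j, if_pos hu, Finset.sup_le_iff]
    intro w hw
    have := h w (Finset.mem_of_mem_erase hw)
    beta_reduce at this
    omega
  have hbest : ∀ b u, j u b + 1 + 1 ≤ headRun b (σ u) → u ∈ W b ∧
      ∀ w ∈ W b, w ≠ u → headRun b (σ w) + d b u < headRun b (σ u) + d b w := by
    intro b u h
    have hle := headRun_le b (σ u)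
    by_cases hu : u ∈ W b
    · refine ⟨hu, fun w hw hwu => ?_⟩
      have := Finset.le_sup (f := fun w => headRun b (σ w) + d b u - (d b w + 1))
        (Finset.mem_erase.mpr ⟨hwu, hw⟩)
      simp only [j, if_pos hu] at h
      omega
    · simp only [j, if_neg hu] at h
      omega
  have hunique : ∀ b, (Finset.univ.filter fun u => j u b + 1 + 1 ≤ headRun b (σ u)).card ≤ 1 := by
    intro b
    refine Finset.card_le_one.mpr fun u hu w hw => ?_
    by_contra hne
    obtain ⟨hu1, hu2⟩ := hbest b u (Finset.mem_filter.mp hu).2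
    obtain ⟨hw1, hw2⟩ := hbest b w (Finset.mem_filter.mp hw).2
    have h1 := hu2 w hw1 (Ne.symm hne)
    have h2 := hw2 u hu1 hne
    omega
  let N := Fintype.card (S × Fin L → Bool)
  have htail : 2 ^ L * ∑ u : V, (Finset.univ.filter fun b : S × Fin L → Bool =>
      L ≤ headRun b (σ u)).card ≤ 2 ^ L * N := by
    rw [Finset.mul_sum]
    refine (Finset.sum_le_sum fun u _ => two_pow_mul_card_headRun_eq_le (σ u)).trans ?_
    rw [Finset.sum_const, smul_eq_mul, Finset.card_univ]
    exact Nat.mul_le_mul_right _ hL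
  have htail := Nat.le_of_mul_le_mul_left htail (by positivity)
  have hswap : ∀ (P : V → (S × Fin L → Bool) → Prop) [∀ u b, Decidable (P u b)],
      ∑ b, (Finset.univ.filter fun u => P u b).card =
        ∑ u, (Finset.univ.filter fun b => P u b).card := by
    intro P _
    simp only [Finset.card_filter]
    exact Finset.sum_comm
  have hsum : ∑ u, (Finset.univ.filter fun b => j u b + 1 + 1 ≤ headRun b (σ u)).card ≤ N := by
    rw [← hswap fun u b => j u b + 1 + 1 ≤ headRun b (σ u)]
    refine (Finset.sum_le_sum fun b _ => hunique b).trans ?_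
    simp [N]
  calc ∑ b, (nearMaximizers (W b) (d b) fun u => headRun b (σ u)).card
      ≤ ∑ b, (Finset.univ.filter fun u => j u b ≤ headRun b (σ u)).card := by
        refine Finset.sum_le_sum fun b _ => Finset.card_le_card fun u hu => ?_
        simpa using hnear b u hu
    _ = ∑ u, (Finset.univ.filter fun b => j u b ≤ headRun b (σ u)).card :=
        hswap fun u b => j u b ≤ headRun b (σ u)
    _ ≤ ∑ u, (4 * (Finset.univ.filter fun b => j u b + 1 + 1 ≤ headRun b (σ u)).card +
          3 * (Finset.univ.filter fun b : S × Fin L → Bool => L ≤ headRun b (σ u)).card) := by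
        refine Finset.sum_le_sum fun u _ => ?_
        have h1 := card_le_headRun_le (σ u) (j u) (hj u)
        have h2 := card_le_headRun_le (σ u) (fun b => j u b + 1) (by simp [hj])
        omega
    _ ≤ 7 * N := by
        rw [Finset.sum_add_distrib, ← Finset.mul_sum, ← Finset.mul_sum]
        omega

/-- Expectations over finitely many fair coins are averages over their outcomes. -/
theorem integral_fairCoins_comp {V ι : Type*} [Fintype ι] [DecidableEq ι] (e : ι ↪ V × ℕ × ℕ)
    (f : (ι → Bool) → ℝ) :
    Integrable (fun ω => f fun i => ω (e i)) (fairCoins V) ∧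
      ∫ ω, f (fun i => ω (e i)) ∂(fairCoins V) =
        (∑ b, f b) / Fintype.card (ι → Bool) := by
  set g : CoinTosses V → ι → Bool := fun ω i => ω (e i) with hg
  have hmeas : Measurable g := by fun_prop
  set ν := (fairCoins V).map g with hν
  have : IsProbabilityMeasure ν := Measure.isProbabilityMeasure_map hmeas.aemeasurable
  have hint : Integrable f ν := .of_finite
  have hsingle : ∀ b, ν.real {b} = ((Fintype.card (ι → Bool) : ℝ))⁻¹ := by
    intro b
    have hpre : g ⁻¹' {b} = Set.pi (Finset.univ.map e : Finset (V × ℕ × ℕ))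
        (Function.extend e (fun i => ({b i} : Set Bool)) fun _ => Set.univ) := by
      ext ω
      simp [hg, funext_iff, e.injective.extend_apply]
    have hcoin : ∀ x : Bool, (PMF.uniformOfFintype Bool).toMeasure {x} = 2⁻¹ := by
      intro x
      rw [PMF.toMeasure_apply_singleton _ _ (measurableSet_singleton x)]
      simp
    rw [measureReal_def, hν, Measure.map_apply hmeas (measurableSet_singleton b), hpre, fairCoins,
      Measure.infinitePi_pi _ (fun _ _ => MeasurableSet.of_discrete), Finset.prod_map]
    simp [e.injective.extend_apply, hcoin]
  refine ⟨hint.comp_measurable hmeas, ?_⟩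
  rw [← integral_map (φ := g) (f := f) hmeas.aemeasurable hint.aestronglyMeasurable,
    integral_fintype hint]
  simp only [hsingle, smul_eq_mul]
  rw [← Finset.mul_sum, inv_mul_eq_div]

end Counting

/-! ### The distributed algorithm -/

section Algorithm

/-- The number with the given binary digits, least significant first: the inverse of `Nat.bits`. -/
def ofBits (l : List Bool) : ℕ := l.foldr Nat.bit 0

theorem ofBits_bits (n : ℕ) : ofBits n.bits = n := by
  induction n using Nat.binaryRec' with
  | zero => simp [ofBits]
  | bit b n h ih =>
    rw [Nat.bits_append_bit _ _ h]
    simp only [ofBits, List.foldr_cons] at ih ⊢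
    rw [ih]

/-- The local version of `flood`: a vertex with value `x` receives `κ i` from each `i ∈ N`. -/
def localFlood (N : Finset ℕ) (δ x : ℕ) (κ : ℕ → ℕ) : ℕ := max x (N.sup fun i => κ i - δ)

/-- The local version of `picks`: a vertex with key `x` receives the keys `κ i` for `i ∈ N`. -/
def localPicks (N : Finset ℕ) (K x : ℕ) (κ : ℕ → ℕ) : Finset ℕ :=
  N.filter fun j => x / K ≤ κ j / K ∧ ∀ i ∈ N, κ i % K = κ j % K → κ i < κ j ∨ κ i = κ j ∧ j ≤ i

/-- The part of the state of a vertex that changes. The parameter `j` counts down the remaining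
rounds of a flooding, `q` is the number of certificates found so far, and `S` is the set of the
neighbours along edges that are in these certificates.

* `grow k j M`: the identifiers are being flooded for `k` rounds; `M` is the largest one seen.
* `alarm k j M f`: after that, the indicator `f` of a disagreement about `M` is being flooded for
  `2 * k` rounds.
* `draw M q S`: all vertices agree that `M` is the largest identifier, and toss coins.
* `spread M q j x S`: the keys `x` are being flooded.
* `tell M q S P`: the set `P` of neighbours has been picked, who are about to be told.
* `done S`: the vertex has halted. -/
inductive Stage where
  | grow (k j M : ℕ)
  | alarm (k j M f : ℕ)
  | draw (M q : ℕ) (S : Finset ℕ)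
  | spread (M q j x : ℕ) (S : Finset ℕ)
  | tell (M q : ℕ) (S P : Finset ℕ)
  | done (S : Finset ℕ)

namespace Stage

/-- The number sent to the neighbour with identifier `i`. -/
def value : Stage → ℕ → ℕ
  | grow _ _ M, _ => M
  | alarm _ _ _ f, _ => f
  | draw _ _ _, _ => 0
  | spread _ _ _ x _, _ => x
  | tell _ _ _ P, i => if i ∈ P then 1 else 0
  | done _, _ => 0

/-- The number of coins tossed. -/
def coins : Stage → ℕ
  | draw M _ _ => M.size
  | _ => 0

/-- The answer of a vertex that has halted. -/
def answer : Stage → Option (Finset ℕ)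
  | done S => some S
  | _ => none

/-- The transition of a vertex with identifier `a` and neighbours `N` which receives the numbers `κ`
and whose coins show `b`. -/
def next (a : ℕ) (N : Finset ℕ) : Stage → (ℕ → ℕ) → List Bool → Stage
  | grow k (j + 1) M, κ, _ => grow k j (localFlood N 0 M κ)
  | grow k 0 M, κ, _ => alarm k (2 * k) M (if ∃ i ∈ N, κ i ≠ M then 1 else 0)
  | alarm k (j + 1) M f, κ, _ => alarm k j M (localFlood N 0 f κ)
  | alarm k 0 M f, _, _ => if f = 0 then draw M 0 ∅ else grow (2 * k) (2 * k) a
  | draw M q S, _, b => spread M q M.size (leadingHeads b * (M + 1) + a) S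
  | spread M q (j + 1) x S, κ, _ => spread M q j (localFlood (N \ S) (M + 1) x κ) S
  | spread M q 0 x S, κ, _ => tell M q S (localPicks (N \ S) (M + 1) x κ)
  | tell M q S P, κ, _ =>
    if q = 2 then done (S ∪ (P ∪ N.filter fun i => κ i = 1))
    else draw M (q + 1) (S ∪ (P ∪ N.filter fun i => κ i = 1))
  | done S, _, _ => done S

end Stage

/-- The state of a vertex: its identifier, those of its neighbours, and its stage. -/
structure VertexState where
  id : ℕ
  nbrs : Finset ℕ
  stage : Stage

/-- First the vertices determine the largest identifier `M`, by flooding for `k = 1, 2, 4, …` rounds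
until nobody raises the alarm. Then they compute three edge-disjoint certificates with keys to the
base `K = M + 1` and shifts of at most `L = M.size`, so that `2 ^ L` is at least the number of
vertices. A vertex without neighbours is alone in a connected network and halts at once. -/
def threeECSSAlgorithm : DistributedAlgorithm where
  State := VertexState
  init a N := ⟨a, N, if N = ∅ then .done ∅ else .grow 1 1 a⟩
  send s i := (s.stage.value i).bits
  coins s := s.stage.coins
  step s inbox b := ⟨s.id, s.nbrs, s.stage.next s.id s.nbrs (fun i => ofBits (inbox i)) b⟩
  output s := s.stage.answer

end Algorithm

/-! ### Simulation of the algorithm -/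

section Simulation

open DistributedAlgorithm

variable {V : Type*}

/-- The shifts drawn in round `t`. -/
def drawnShift (ω : CoinTosses V) (L t : ℕ) (v : V) : ℕ :=
  leadingHeads (List.ofFn fun i : Fin L => ω (v, t, i))

theorem drawnShift_le (ω : CoinTosses V) (L t : ℕ) (v : V) : drawnShift ω L t v ≤ L := by
  simpa [drawnShift] using leadingHeads_le_length (List.ofFn fun i : Fin L => ω (v, t, i))

variable [Fintype V] (G : SimpleGraph V) (ids : V ↪ ℕ)

variable {G ids} in
theorem mem_neighborIds {v u : V} : ids u ∈ neighborIds G ids v ↔ G.Adj v u := by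
  simp [neighborIds]

theorem neighborIds_sdiff (H : SimpleGraph V) (v : V) :
    neighborIds G ids v \ neighborIds H ids v = neighborIds (G \ H) ids v := by
  classical
  ext i
  simp only [neighborIds, Finset.mem_sdiff, Finset.mem_map, Finset.mem_filter, Finset.mem_univ,
    true_and, SimpleGraph.sdiff_adj]
  constructor
  · rintro ⟨⟨u, hu, rfl⟩, h⟩
    exact ⟨u, ⟨hu, fun h' => h ⟨u, h', rfl⟩⟩, rfl⟩
  · rintro ⟨u, ⟨hu, h⟩, rfl⟩
    exact ⟨⟨u, hu, rfl⟩, fun ⟨w, hw, he⟩ => h (ids.injective he ▸ hw)⟩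

theorem localFlood_eq (δ : ℕ) (x : V → ℕ) (v : V) (κ : ℕ → ℕ)
    (h : ∀ u, G.Adj v u → κ (ids u) = x u) :
    localFlood (neighborIds G ids v) δ (x v) κ = flood G δ x v := by
  classical
  unfold localFlood flood neighborIds
  rw [Finset.sup_map]
  congr 1
  refine Finset.sup_congr rfl fun u hu => ?_
  simp [h u (by simpa using hu)]

open Classical in
theorem localPicks_eq (K : ℕ) (key : V → ℕ) (v : V) (κ : ℕ → ℕ)
    (h : ∀ u, G.Adj v u → κ (ids u) = key u) :
    localPicks (neighborIds G ids v) K (key v) κ = (picks ids K G key v).map ids := by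
  ext i
  simp only [localPicks, picks, Finset.mem_filter, Finset.mem_map, Finset.mem_univ, true_and]
  constructor
  · rintro ⟨hi, h1, h2⟩
    obtain ⟨u, hu, rfl⟩ : ∃ u, G.Adj v u ∧ ids u = i := by simpa [neighborIds] using hi
    refine ⟨u, ⟨hu, by rwa [← h u hu], fun w hw hc => ?_⟩, rfl⟩
    have := h2 (ids w) (mem_neighborIds.mpr hw)
    rw [h u hu, h w hw] at this
    exact this hc
  · rintro ⟨u, ⟨hu, h1, h2⟩, rfl⟩
    refine ⟨mem_neighborIds.mpr hu, by rwa [h u hu], fun i hi hc => ?_⟩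
    obtain ⟨w, hw, rfl⟩ : ∃ u, G.Adj v u ∧ ids u = i := by simpa [neighborIds] using hi
    rw [h u hu, h w hw] at hc ⊢
    exact h2 w hw hc

/-- The global state in which every vertex `v` is in the stage `st v`. -/
noncomputable def config (st : V → Stage) (v : V) : VertexState :=
  ⟨ids v, neighborIds G ids v, st v⟩

/-- Under the coin tosses `ω`, if the stages are `st` in round `t`, then they are `st'` in the later
round `t'`, and all messages sent in between have at most `b` bits. -/
def Leads (ω : CoinTosses V) (b t : ℕ) (st : V → Stage) (t' : ℕ) (st' : V → Stage) : Prop :=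
  threeECSSAlgorithm.run G ids ω t = config G ids st →
    threeECSSAlgorithm.run G ids ω t' = config G ids st' ∧ ∀ i, t ≤ i → i < t' → ∀ u v,
      (threeECSSAlgorithm.message G ids (threeECSSAlgorithm.run G ids ω i) u v).length ≤ b

variable {G ids} {ω : CoinTosses V} {b : ℕ}

theorem Leads.refl (t : ℕ) (st : V → Stage) : Leads G ids ω b t st t st :=
  fun h => ⟨h, fun i h1 h2 => by omega⟩

theorem Leads.trans {t t' t'' : ℕ} {st st' st'' : V → Stage} (h : Leads G ids ω b t st t' st')
    (h' : Leads G ids ω b t' st' t'' st'') : Leads G ids ω b t st t'' st'' := by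
  intro hst
  obtain ⟨h1, h2⟩ := h hst
  obtain ⟨h3, h4⟩ := h' h1
  refine ⟨h3, fun i hi hi' => ?_⟩
  rcases lt_or_ge i t' with hlt | hge
  · exact h2 i hi hlt
  · exact h4 i hge hi'

/-- One round in which every vertex is running. The hypothesis on `st'` describes the new stages in
terms of the numbers that a vertex receives from its neighbours; the others are arbitrary. -/
theorem leads_succ {t : ℕ} {st st' : V → Stage} (hrun : ∀ v, (st v).answer = none)
    (hval : ∀ v i, (st v).value i < 2 ^ b)
    (hnext : ∀ v κ, (∀ u, G.Adj v u → κ (ids u) = (st u).value (ids v)) →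
      st' v = (st v).next (ids v) (neighborIds G ids v) κ
        (List.ofFn fun i : Fin (st v).coins => ω (v, t, i))) :
    Leads G ids ω b t st (t + 1) st' := by
  classical
  intro hst
  have hmsg : ∀ u v, (threeECSSAlgorithm.message G ids (config G ids st) u v) =
      if G.Adj u v then ((st u).value (ids v)).bits else [] := by
    intro u v
    simp [message, threeECSSAlgorithm, config, hrun]
  constructor
  · funext v
    rw [run]
    simp only [hst]
    rw [show threeECSSAlgorithm.output (config G ids st v) = none from hrun v]
    simp only [config]
    rw [hnext v (fun i => ofBits (threeECSSAlgorithm.inbox G ids (config G ids st) v i)) ?_]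
    · rfl
    · intro u hu
      rw [show threeECSSAlgorithm.inbox G ids (config G ids st) v = Function.extend ids
        (fun u => threeECSSAlgorithm.message G ids (config G ids st) u v) fun _ => [] from rfl,
        ids.injective.extend_apply, hmsg, if_pos hu.symm, ofBits_bits]
  · intro i hi hi' u v
    obtain rfl : i = t := by omega
    rw [hst, hmsg]
    split_ifs
    · rw [Nat.size_eq_bits_len, Nat.size_le]
      exact hval _ _
    · exact Nat.zero_le _

theorem leads_grow {t k j : ℕ} {x : V → ℕ} (hx : ∀ v, x v < 2 ^ b) :
    Leads G ids ω b t (fun v => .grow k j (x v)) (t + j)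
      (fun v => .grow k 0 ((flood G 0)^[j] x v)) := by
  induction j generalizing t x with
  | zero => exact .refl _ _
  | succ j ih =>
    have h := ih (t := t + 1) (x := flood G 0 x) fun v =>
      Nat.lt_of_le_pred (by positivity)
        (flood_iterate_le (G := G) (δ := 0) (fun v => Nat.le_pred_of_lt (hx v)) 1 v)
    rw [show t + (j + 1) = t + 1 + j by omega]
    refine .trans (leads_succ (fun _ => rfl) (fun v _ => hx v) fun v κ hκ => ?_) h
    simp only [Stage.next]
    rw [localFlood_eq G ids 0 x v κ fun u hu => hκ u hu]

theorem leads_alarm {t k j : ℕ} {M f : V → ℕ} (hf : ∀ v, f v < 2 ^ b) :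
    Leads G ids ω b t (fun v => .alarm k j (M v) (f v)) (t + j)
      (fun v => .alarm k 0 (M v) ((flood G 0)^[j] f v)) := by
  induction j generalizing t f with
  | zero => exact .refl _ _
  | succ j ih =>
    have h := ih (t := t + 1) (f := flood G 0 f) fun v =>
      Nat.lt_of_le_pred (by positivity)
        (flood_iterate_le (G := G) (δ := 0) (fun v => Nat.le_pred_of_lt (hf v)) 1 v)
    rw [show t + (j + 1) = t + 1 + j by omega]
    refine .trans (leads_succ (fun _ => rfl) (fun v _ => hf v) fun v κ hκ => ?_) h
    simp only [Stage.next]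
    rw [localFlood_eq G ids 0 f v κ fun u hu => hκ u hu]

/-- One attempt to determine the largest identifier, up to the decision. -/
theorem leads_grow_alarm {t k : ℕ} (hb : 1 ≤ b) (hids : ∀ v, ids v < 2 ^ b) :
    Leads G ids ω b t (fun v => .grow k k (ids v)) (t + k + 1 + 2 * k)
      (fun v => .alarm k 0 ((flood G 0)^[k] ids v)
        ((flood G 0)^[2 * k] (disagree G ((flood G 0)^[k] ids)) v)) := by
  have h1 : 1 < 2 ^ b := Nat.one_lt_two_pow (by omega)
  refine .trans (leads_grow hids) (.trans (leads_succ (fun _ => rfl) (fun v _ => ?_) ?_)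
    (leads_alarm fun v => (disagree_le_one _ _ _).trans_lt h1))
  · exact Nat.lt_of_le_pred (by positivity)
        (flood_iterate_le (G := G) (δ := 0) (fun v => Nat.le_pred_of_lt (hids v)) k v)
  · intro v κ hκ
    simp only [Stage.next, disagree]
    congr 2
    refine propext ⟨?_, ?_⟩
    · rintro ⟨u, hu, hne⟩
      exact ⟨ids u, mem_neighborIds.mpr hu, by rw [hκ u hu]; exact hne⟩
    · rintro ⟨i, hi, hne⟩
      obtain ⟨u, hu, rfl⟩ : ∃ u, G.Adj v u ∧ ids u = i := by simpa [neighborIds] using hi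
      exact ⟨u, hu, by rwa [hκ u hu] at hne⟩

/-- The number of flooding rounds doubles until it reaches the diameter at the latest, so that all
attempts together take `O(D)` rounds. The attempt with `k` rounds of flooding takes
`3 * k + 2 ≤ 5 * k` rounds, and the bound `20 * D - 5 * k` on the remaining time drops by `5 * k`
when `k` doubles. -/
theorem exists_leads_draw (hG : G.Connected) (hb : 1 ≤ b) (hids : ∀ v, ids v < 2 ^ b) {k : ℕ}
    (hk : 1 ≤ k) (hkD : k ≤ 2 * G.diam) (t : ℕ) :
    ∃ t' M : ℕ, t' + 5 * k ≤ t + 20 * G.diam ∧ (∀ v, ids v ≤ M) ∧ (∃ v, ids v = M) ∧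
      ∀ ω, Leads G ids ω b t (fun v => .grow k k (ids v)) t' (fun _ => .draw M 0 ∅) := by
  induction hn : 2 * G.diam - k using Nat.strong_induction_on generalizing k t with
  | _ n ih =>
  have hiff := flood_disagree_eq_zero_iff hG ids.injective k
  have hpos : 0 < 2 ^ b := by positivity
  by_cases hconst : ∀ u w, (flood G 0)^[k] ids u = (flood G 0)^[k] ids w
  · obtain ⟨v⟩ := hG.nonempty
    obtain ⟨u, p, -, hu⟩ := exists_walk_flood_iterate G 0 ids k v
    refine ⟨t + k + 1 + 2 * k + 1, (flood G 0)^[k] ids v, by omega,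
      fun w => le_of_flood_iterate_const hconst w v, ⟨u, by simpa using hu.symm⟩, fun ω => ?_⟩
    refine .trans (leads_grow_alarm hb hids) (leads_succ (fun _ => rfl) (fun w _ => ?_) ?_)
    · simp only [Stage.value, (hiff w).mpr hconst]
      exact hpos
    · intro w κ _
      simp only [Stage.next, (hiff w).mpr hconst, if_true]
      rw [hconst v w]
  · have hlt : k < G.diam := by
      by_contra! h
      exact hconst (flood_iterate_eq_of_diam_le hG _ h)
    obtain ⟨t', M, ht', hM, hM', h⟩ := ih _ (by omega) (k := 2 * k) (by omega) (by omega)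
      (t + k + 1 + 2 * k + 1) rfl
    refine ⟨t', M, by omega, hM, hM', fun ω => .trans (leads_grow_alarm hb hids)
      (.trans (leads_succ (fun _ => rfl) (fun w _ => ?_) ?_) (h ω))⟩
    · exact ((flood_iterate_le (fun v => disagree_le_one _ _ v) _ _).trans_lt
        (Nat.one_lt_two_pow (by omega)))
    · intro w κ _
      simp only [Stage.next]
      rw [if_neg fun h => hconst ((hiff w).mp h)]

theorem leads_spread {t M q j : ℕ} {H : SimpleGraph V} {x : V → ℕ}
    (hx : ∀ i v, (flood (G \ H) (M + 1))^[i] x v < 2 ^ b) :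
    Leads G ids ω b t (fun v => .spread M q j (x v) (neighborIds H ids v)) (t + j)
      (fun v => .spread M q 0 ((flood (G \ H) (M + 1))^[j] x v) (neighborIds H ids v)) := by
  induction j generalizing t x with
  | zero => exact .refl _ _
  | succ j ih =>
    have h := ih (t := t + 1) (x := flood (G \ H) (M + 1) x) fun i v => hx (i + 1) v
    rw [show t + (j + 1) = t + 1 + j by omega]
    refine .trans (leads_succ (fun _ => rfl) (fun v _ => hx 0 v) fun v κ hκ => ?_) h
    simp only [Stage.next, neighborIds_sdiff]
    rw [localFlood_eq (G \ H) ids (M + 1) x v κ fun u hu => hκ u hu.1]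

/-- The computation of one certificate. -/
theorem leads_tell {t M q : ℕ} {H : SimpleGraph V} (hM : ∀ v, ids v ≤ M)
    (hb : (M.size + 1) * (M + 1) ≤ 2 ^ b) :
    Leads G ids ω b t (fun v => .draw M q (neighborIds H ids v)) (t + 1 + M.size + 1)
      (fun v => .tell M q (neighborIds H ids v) ((picks ids (M + 1) (G \ H)
        (finalKey ids (M + 1) M.size (G \ H) (drawnShift ω M.size t)) v).map ids)) := by
  have hlt : ∀ i v, (flood (G \ H) (M + 1))^[i]
      (initialKey ids (M + 1) (drawnShift ω M.size t)) v < 2 ^ b := fun i v =>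
    (finalKey_lt (drawnShift_le ω M.size t) (fun v => Nat.lt_succ_of_le (hM v)) i v).trans_le hb
  refine .trans (st' := fun v => .spread M q M.size
      (initialKey ids (M + 1) (drawnShift ω M.size t) v) (neighborIds H ids v))
    (leads_succ (fun _ => rfl) (fun _ _ => ?_) (fun _ _ _ => rfl)) (.trans (leads_spread hlt)
      (leads_succ (fun _ => rfl) (fun v _ => hlt _ v) fun v κ hκ => ?_))
  · exact Nat.two_pow_pos b
  · simp only [Stage.next, neighborIds_sdiff]
    exact congrArg (Stage.tell M q _) (localPicks_eq (G \ H) ids (M + 1)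
      (finalKey ids (M + 1) M.size (G \ H) (drawnShift ω M.size t)) v κ fun u hu => hκ u hu.1).symm

theorem neighborIds_sup_certificate {H : SimpleGraph V} {K L : ℕ} {r : V → ℕ} (v : V) (κ : ℕ → ℕ)
    (hκ : ∀ u, G.Adj v u → κ (ids u) =
      if ids v ∈ (picks ids K (G \ H) (finalKey ids K L (G \ H) r) u).map ids then 1 else 0) :
    neighborIds H ids v ∪ ((picks ids K (G \ H) (finalKey ids K L (G \ H) r) v).map ids ∪
      (neighborIds G ids v).filter fun i => κ i = 1) =
    neighborIds (H ⊔ certificate ids K L (G \ H) r) ids v := by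
  classical
  ext i
  by_cases hi : ∃ u, ids u = i
  · obtain ⟨u, rfl⟩ := hi
    simp only [Finset.mem_union, Finset.mem_filter, mem_neighborIds, SimpleGraph.sup_adj,
      Finset.mem_map', certificate, SimpleGraph.fromRel_adj]
    refine or_congr_right ⟨?_, ?_⟩
    · rintro (h | ⟨h, h1⟩)
      · exact ⟨(adj_of_mem_picks h).ne, Or.inl h⟩
      · refine ⟨h.ne, Or.inr ?_⟩
        rw [hκ u h] at h1
        by_contra hcon
        rw [if_neg (by simpa using hcon)] at h1
        simp at h1
    · rintro ⟨-, h | h⟩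
      · exact Or.inl h
      · have hadj : G.Adj v u := (adj_of_mem_picks h).symm.1
        exact Or.inr ⟨hadj, by rw [hκ u hadj, if_pos (by simpa using h)]⟩
  · have : ∀ u, ids u ≠ i := fun u h => hi ⟨u, h⟩
    simp [neighborIds, this]

theorem leads_certificates {t M : ℕ} (hM : ∀ v, ids v ≤ M) (hb1 : 1 ≤ b)
    (hb : (M.size + 1) * (M + 1) ≤ 2 ^ b) :
    Leads G ids ω b t (fun _ => .draw M 0 ∅) (t + 3 * (M.size + 3)) (fun v => .done (neighborIds
      (certificateUnion ids (M + 1) M.size G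
        (fun q => drawnShift ω M.size (t + q * (M.size + 3))) 3) ids v)) := by
  set U := certificateUnion ids (M + 1) M.size G
    (fun q => drawnShift ω M.size (t + q * (M.size + 3))) with hU
  have h1 : ∀ (P : Finset ℕ) i, (if i ∈ P then 1 else 0) < 2 ^ b := by
    intro P i
    have : 1 < 2 ^ b := Nat.one_lt_two_pow (by omega)
    split_ifs <;> omega
  have hstep : ∀ q (st' : V → Stage),
      (∀ v, st' v = if q = 2 then .done (neighborIds (U (q + 1)) ids v)
        else .draw M (q + 1) (neighborIds (U (q + 1)) ids v)) →
      Leads G ids ω b (t + q * (M.size + 3)) (fun v => .draw M q (neighborIds (U q) ids v))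
        (t + (q + 1) * (M.size + 3)) st' := by
    intro q st' hst'
    rw [show t + (q + 1) * (M.size + 3) = t + q * (M.size + 3) + 1 + M.size + 1 + 1 by ring]
    refine .trans (leads_tell hM hb) (leads_succ (fun _ => rfl) (fun v i => h1 _ _) ?_)
    intro v κ hκ
    simp only [Stage.next]
    rw [neighborIds_sup_certificate v κ hκ, hst']
    rfl
  have h0 : (fun v => Stage.draw M 0 (neighborIds (U 0) ids v)) = fun _ => .draw M 0 ∅ := by
    funext v
    simp [hU, certificateUnion, neighborIds]
  have s0 := hstep 0 _ fun _ => rfl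
  have s1 := hstep 1 _ fun _ => rfl
  have s2 := hstep 2 _ fun _ => rfl
  simp only [h0, zero_mul, add_zero] at s0
  exact (s0.trans s1).trans s2

end Simulation

/-! ### The expected size of the solution -/

section ExpectedSize

variable {V : Type*} [Fintype V] {G : SimpleGraph V} {ids : V ↪ ℕ}

/-- With `2 ^ L` at least the number of vertices, the average size of a union of three successive
certificates is at most `21` times the number of vertices. The `q`-th certificate is taken in a
graph that depends on the coins of the earlier ones only. -/
theorem sum_card_certificateUnion_le [DecidableEq V] {K L : ℕ} (hK : ∀ v, ids v < K)
    (hL : Fintype.card V ≤ 2 ^ L) (r : ((V × Fin 3) × Fin L → Bool) → ℕ → V → ℕ)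
    (hr : ∀ b (q : Fin 3), r b q = fun v => headRun b (v, q)) :
    ∑ b, (certificateUnion ids K L G (r b) 3).edgeSet.ncard ≤
      21 * Fintype.card V * Fintype.card ((V × Fin 3) × Fin L → Bool) := by
  classical
  let U := fun b q => certificateUnion ids K L G (r b) q
  have hone : ∀ (q : Fin 3) (v : V), ∑ b, (picks ids K (G \ U b q)
      (finalKey ids K L (G \ U b q) (r b q)) v).card ≤
        7 * Fintype.card ((V × Fin 3) × Fin L → Bool) := by
    intro q v
    have hU : ∀ b u i a, U (Function.update b ((u, q), i) a) q = U b q := by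
      intro b u i a
      refine certificateUnion_congr fun p hp => ?_
      have hp3 : p < 3 := hp.trans q.2
      have := hr (Function.update b ((u, q), i) a) ⟨p, hp3⟩
      have := hr b ⟨p, hp3⟩
      simp only at *
      simp only [*]
      funext w
      unfold headRun
      congr 2
      funext k
      rw [Function.update_of_ne]
      intro h
      simp only [Prod.mk.injEq] at h
      exact hp.ne (congrArg Fin.val h.1.2)
    refine le_trans (Finset.sum_le_sum fun b _ => ?_) (sum_card_nearMaximizers_le
      (σ := .sectL V q)
      (fun b => Finset.univ.filter ((G \ U b q).Reachable v)) (fun b => (G \ U b q).dist v)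
      (fun b u i a => ?_) (fun b u i a => ?_) hL)
    · have := card_picks_le (ids := ids) (K := K) (G := G \ U b q) (r := r b q) (L := L)
        (by rw [hr]; exact fun v => headRun_le _ _) hK v
      simpa [hr] using this
    · simp only [Function.Embedding.sectL_apply, hU]
    · simp only [Function.Embedding.sectL_apply, hU]
  calc ∑ b, (U b 3).edgeSet.ncard
      ≤ ∑ b, ∑ q : Fin 3, ∑ v, (picks ids K (G \ U b q)
          (finalKey ids K L (G \ U b q) (r b q)) v).card := by
        refine Finset.sum_le_sum fun b _ => (card_edgeSet_certificateUnion_le 3).trans ?_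
        rw [← Fin.sum_univ_eq_sum_range fun p => (certificate ids K L (G \ U b p)
          (r b p)).edgeSet.ncard]
        exact Finset.sum_le_sum fun q _ => card_edgeSet_certificate_le
    _ = ∑ q : Fin 3, ∑ v, ∑ b, (picks ids K (G \ U b q)
          (finalKey ids K L (G \ U b q) (r b q)) v).card := by
        rw [Finset.sum_comm]
        exact Finset.sum_congr rfl fun q _ => Finset.sum_comm
    _ ≤ ∑ q : Fin 3, ∑ v : V, 7 * Fintype.card ((V × Fin 3) × Fin L → Bool) :=
        Finset.sum_le_sum fun q _ => Finset.sum_le_sum fun v _ => hone q v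
    _ = _ := by
        simp only [Finset.sum_const, Finset.card_univ, Fintype.card_fin, smul_eq_mul]
        ring

theorem integral_card_certificateUnion_le {K L : ℕ} (hK : ∀ v, ids v < K)
    (hL : Fintype.card V ≤ 2 ^ L) (t : ℕ) :
    let N := fun ω => ((certificateUnion ids K L G
      (fun q => drawnShift ω L (t + q * (L + 3))) 3).edgeSet.ncard : ℝ)
    Integrable N (fairCoins V) ∧ ∫ ω, N ω ∂(fairCoins V) ≤ 21 * Fintype.card V := by
  classical
  intro N
  let e : (V × Fin 3) × Fin L ↪ V × ℕ × ℕ :=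
    ⟨fun x => (x.1.1, t + x.1.2 * (L + 3), x.2), by
      rintro ⟨⟨v, q⟩, i⟩ ⟨⟨v', q'⟩, i'⟩ h
      simp only [Prod.mk.injEq] at h
      obtain ⟨h1, h2, h3⟩ := h
      have h4 : (q : ℕ) = q' := Nat.eq_of_mul_eq_mul_right (Nat.succ_pos (L + 2))
        (Nat.add_left_cancel h2)
      rw [h1, Fin.ext h4, Fin.ext h3]⟩
  let r : ((V × Fin 3) × Fin L → Bool) → ℕ → V → ℕ := fun b q v =>
    if h : q < 3 then headRun b (v, ⟨q, h⟩) else 0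
  have hr : ∀ b (q : Fin 3), r b q = fun v => headRun b (v, q) := by
    intro b q
    funext v
    simp [r]
  let f : ((V × Fin 3) × Fin L → Bool) → ℝ := fun b =>
    ((certificateUnion ids K L G (r b) 3).edgeSet.ncard : ℝ)
  have hN : N = fun ω => f fun x => ω (e x) := by
    funext ω
    simp only [N, f]
    rw [certificateUnion_congr]
    intro q hq
    funext v
    simp only [r, hq, dif_pos]
    rfl
  obtain ⟨h1, h2⟩ := integral_fairCoins_comp e f
  rw [hN]
  refine ⟨h1, ?_⟩
  rw [h2, div_le_iff₀ (by exact_mod_cast Fintype.card_pos)]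
  simp only [f]
  exact_mod_cast sum_card_certificateUnion_le hK hL r hr

end ExpectedSize

/-! ### The optimum, and the complete execution -/

/-- A `k`-edge-connected spanning subgraph is connected, hence has at least as many edges as a
tree. -/
theorem card_le_minECSSSize_add_one {V : Type*} [Fintype V] [Nonempty V] {G : SimpleGraph V} {k : ℕ}
    (hk : k ≠ 0) (hG : G.IsEdgeConnected k) : Fintype.card V ≤ minECSSSize k G + 1 := by
  have hne : {m | ∃ H, IsECSS k G H ∧ H.edgeSet.ncard = m}.Nonempty := ⟨_, G, ⟨le_rfl, hG⟩, rfl⟩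
  obtain ⟨H, hH, hcard⟩ := Nat.sInf_mem hne
  have := (hH.2.connected hk).card_vert_le_card_edgeSet_add_one
  rw [Nat.card_eq_fintype_card, Nat.card_coe_set_eq, hcard] at this
  exact this

section Execution

open DistributedAlgorithm

variable {V : Type*} [Fintype V] {G : SimpleGraph V} {ids : V ↪ ℕ}

theorem messagesBoundedBy_of_halted {A : DistributedAlgorithm} {x : ℝ} (hx : 0 ≤ x) (T : ℕ)
    (hlt : ∀ ω, ∀ t < T, ∀ u v, ((A.message G ids (A.run G ids ω t) u v).length : ℝ) ≤ x)
    (hhalt : ∀ ω v, A.output (A.run G ids ω T v) ≠ none) : A.MessagesBoundedBy G ids x := by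
  have hstay : ∀ ω i, A.run G ids ω (T + i) = A.run G ids ω T := by
    intro ω i
    induction i with
    | zero => rfl
    | succ i ih =>
      funext v
      rw [← add_assoc, run]
      simp only [ih]
      split
      · next h => exact absurd h (hhalt ω v)
      · rfl
  intro ω t u v
  rcases lt_or_ge t T with h | h
  · exact hlt ω t h u v
  · obtain ⟨i, rfl⟩ := Nat.exists_eq_add_of_le h
    rw [hstay, message, if_neg fun h => hhalt ω u h.2]
    simpa using hx

/-- The complete execution on a network with at least two vertices. -/
theorem exists_execution [Nontrivial V] (hG : G.Connected) {a : ℕ} (hids : ∀ v, ids v < 2 ^ a) :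
    ∃ t M : ℕ, t ≤ 20 * G.diam ∧ (∀ v, ids v ≤ M) ∧ M.size ≤ a ∧ ∀ ω,
      Leads G ids ω (2 * a + 1) 0 (fun v => .grow 1 1 (ids v)) (t + 3 * (M.size + 3))
        (fun v => .done (neighborIds (certificateUnion ids (M + 1) M.size G
          (fun q => drawnShift ω M.size (t + q * (M.size + 3))) 3) ids v)) := by
  have hD : G.diam ≠ 0 :=
    SimpleGraph.diam_ne_zero_of_ediam_ne_top (SimpleGraph.connected_iff_ediam_ne_top.mp hG)
  obtain ⟨t, M, ht, hM, ⟨v, hv⟩, hlead⟩ := exists_leads_draw (ids := ids) (b := 2 * a + 1) hG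
    (by omega) (fun v => (hids v).trans_le (Nat.pow_le_pow_right two_pos (by omega))) le_rfl
    (by omega) 0
  have hsize : M.size ≤ a := Nat.size_le.mpr (hv ▸ hids v)
  refine ⟨t, M, by omega, hM, hsize, fun ω => (hlead ω).trans (leads_certificates hM (by omega) ?_)⟩
  calc (M.size + 1) * (M + 1) ≤ 2 ^ a * 2 ^ a :=
        Nat.mul_le_mul ((Nat.succ_le_of_lt M.size.lt_two_pow_self).trans
          (Nat.pow_le_pow_right two_pos hsize)) (hv ▸ hids v)
    _ ≤ 2 ^ (2 * a + 1) := by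
        rw [← pow_add]
        exact Nat.pow_le_pow_right two_pos (by omega)

end Execution

theorem mainTheorem4 (c : ℕ) :
    ∃ (A : DistributedAlgorithm) (B C₁ C₂ : ℝ),
      ∀ (V : Type*) [Fintype V] (G : SimpleGraph V) (ids : V ↪ ℕ),
        (∀ v, ids v < Fintype.card V ^ c) → G.IsEdgeConnected 3 →
        -- messages of `O(log n)` bits
        A.MessagesBoundedBy G ids (B * Real.logb 2 (Fintype.card V)) ∧
        ∃ (T : ℕ) (H : CoinTosses V → SimpleGraph V),
          -- `O(D log³ n)` rounds, for all outcomes of the coins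
          (T : ℝ) ≤ C₁ * (G.diam * Real.log (Fintype.card V) ^ 3) ∧
          (∀ ω, A.HaltsWith G ids ω T (H ω)) ∧
          -- the output is always a feasible solution
          (∀ ω, IsECSS 3 G (H ω)) ∧
          -- its expected size is `O(log n)` times the optimum
          Integrable (fun ω => ((H ω).edgeSet.ncard : ℝ)) (fairCoins V) ∧
          ∫ ω, ((H ω).edgeSet.ncard : ℝ) ∂(fairCoins V) ≤
            C₂ * Real.log (Fintype.card V) * minECSSSize 3 G := by
  have hlog2 : 0 < Real.log 2 := Real.log_pos one_lt_two
  refine ⟨threeECSSAlgorithm, 4 * c + 1, (29 + 6 * c) / Real.log 2 ^ 3, 42 / Real.log 2, ?_⟩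
  intro V _ G ids hids hG
  rcases subsingleton_or_nontrivial V with hV | hV
  · -- A single vertex has no neighbours and halts at once.
    have hbot : ∀ H : SimpleGraph V, ∀ v, DistributedAlgorithm.neighborIds H ids v = ∅ := by
      intro H v
      simp [DistributedAlgorithm.neighborIds, Subsingleton.elim H ⊥]
    have hout : ∀ ω v, threeECSSAlgorithm.output (threeECSSAlgorithm.run G ids ω 0 v) = some ∅ := by
      intro ω v
      simp [DistributedAlgorithm.run, threeECSSAlgorithm, hbot, Stage.answer]
    have hlog : 0 ≤ Real.log (Fintype.card V) := Real.log_natCast_nonneg _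
    refine ⟨messagesBoundedBy_of_halted ?_ 0 (by simp) (by simp [hout]), 0, fun _ => ⊥, ?_, ?_,
      ?_, ?_, ?_⟩
    · exact mul_nonneg (by positivity) (div_nonneg hlog hlog2.le)
    · simp only [Nat.cast_zero]
      positivity
    · intro ω v
      rw [hout, hbot]
    · exact fun _ => ⟨bot_le, .of_subsingleton⟩
    · simp
    · simp only [SimpleGraph.edgeSet_bot, Set.ncard_empty, Nat.cast_zero, integral_zero]
      positivity
  · have hconn : G.Connected := hG.connected three_ne_zero
    set n := Fintype.card V with hn
    have hn2 : 2 ≤ n := Fintype.one_lt_card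
    have hD : G.diam ≠ 0 :=
      SimpleGraph.diam_ne_zero_of_ediam_ne_top (SimpleGraph.connected_iff_ediam_ne_top.mp hconn)
    set l := Real.logb 2 n with hl
    have hlog : Real.log n = l * Real.log 2 := by
      rw [hl, Real.logb, div_mul_cancel₀ _ hlog2.ne']
    have hl1 : 1 ≤ l := by
      rw [hl, Real.le_logb_iff_rpow_le one_lt_two (by positivity)]
      simpa using (by exact_mod_cast hn2 : (2 : ℝ) ≤ n)
    have hsize : (n.size : ℝ) ≤ 2 * l := by
      obtain ⟨m, hm⟩ : ∃ m, n.size = m + 1 :=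
        ⟨n.size - 1, by have := Nat.size_pos.mpr (show 0 < n by omega); omega⟩
      have hpow : 2 ^ m ≤ n := Nat.lt_size.mp (by omega)
      have : (m : ℝ) ≤ l := by
        rw [hl, Real.le_logb_iff_rpow_le one_lt_two (by positivity), Real.rpow_natCast]
        exact_mod_cast hpow
      rw [hm]
      push_cast
      linarith
    obtain ⟨t, M, ht, hM, hMsize, hlead⟩ := exists_execution (ids := ids) (a := n.size * c) hconn
      (fun v => (hids v).trans_le (by
        rw [pow_mul]
        exact Nat.pow_le_pow_left (Nat.lt_size_self n).le c))
    have hzero : ∀ ω, threeECSSAlgorithm.run G ids ω 0 =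
        config G ids fun v => .grow 1 1 (ids v) := by
      intro ω
      funext v
      obtain ⟨u, hu⟩ := hconn.preconnected.exists_adj_of_nontrivial v
      have : DistributedAlgorithm.neighborIds G ids v ≠ ∅ :=
        Finset.ne_empty_of_mem (mem_neighborIds.mpr hu)
      simp [DistributedAlgorithm.run, threeECSSAlgorithm, config, this]
    have hnM : n ≤ 2 ^ M.size := by
      have : n ≤ (Finset.range (M + 1)).card :=
        Finset.card_le_card_of_injOn ids (fun v _ => by simpa [Nat.lt_succ_iff] using hM v)
          ids.injective.injOn
      rw [Finset.card_range] at this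
      exact this.trans (Nat.lt_size_self M)
    have hK : ∀ v, ids v < M + 1 := fun v => Nat.lt_succ_of_le (hM v)
    set T := t + 3 * (M.size + 3) with hT
    set H : CoinTosses V → SimpleGraph V := fun ω => certificateUnion ids (M + 1) M.size G
      (fun q => drawnShift ω M.size (t + q * (M.size + 3))) 3 with hH
    have hout : ∀ ω v, threeECSSAlgorithm.output (threeECSSAlgorithm.run G ids ω T v) =
        some (DistributedAlgorithm.neighborIds (H ω) ids v) := by
      intro ω v
      rw [(hlead ω (hzero ω)).1]
      rfl
    have hc : (0 : ℝ) ≤ c := Nat.cast_nonneg c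
    obtain ⟨hint, hle⟩ := integral_card_certificateUnion_le (G := G) hK hnM t
    refine ⟨messagesBoundedBy_of_halted (by positivity) T (fun ω i hi u v => ?_)
      (by simp [hout]), T, H, ?_, hout, fun ω => ⟨certificateUnion_le _,
        isEdgeConnected_certificateUnion (fun q v => drawnShift_le _ _ _ v) hK hG⟩, hint, ?_⟩
    · have h1 := (hlead ω (hzero ω)).2 i (Nat.zero_le _) hi u v
      have h2 : ((threeECSSAlgorithm.message G ids (threeECSSAlgorithm.run G ids ω i) u v).length
          : ℝ) ≤ 2 * (n.size * c) + 1 := by exact_mod_cast h1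
      have h3 : (n.size : ℝ) * c ≤ 2 * l * c := mul_le_mul_of_nonneg_right hsize hc
      nlinarith
    · have hM' : (M.size : ℝ) ≤ 2 * l * c := by
        have : (M.size : ℝ) ≤ n.size * c := by exact_mod_cast hMsize
        exact this.trans (mul_le_mul_of_nonneg_right hsize hc)
      have hD1 : (1 : ℝ) ≤ G.diam := by exact_mod_cast Nat.one_le_iff_ne_zero.mpr hD
      have ht' : (t : ℝ) ≤ 20 * G.diam := by exact_mod_cast ht
      have hl3 : l ≤ l ^ 3 := le_self_pow₀ hl1 (by norm_num)
      have hl3' : 1 ≤ l ^ 3 := hl1.trans hl3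
      have hTle : (T : ℝ) ≤ 20 * G.diam + 6 * c * l + 9 := by
        rw [hT]
        push_cast
        linarith
      have h1 : (G.diam : ℝ) ≤ G.diam * l ^ 3 := le_mul_of_one_le_right (by positivity) hl3'
      have h2 : l ^ 3 ≤ G.diam * l ^ 3 := le_mul_of_one_le_left (by positivity) hD1
      have h3 : (c : ℝ) * l ≤ c * (G.diam * l ^ 3) := mul_le_mul_of_nonneg_left (hl3.trans h2) hc
      calc (T : ℝ) ≤ (29 + 6 * c) * (G.diam * l ^ 3) := by linarith
        _ = (29 + 6 * c) / Real.log 2 ^ 3 * (G.diam * Real.log n ^ 3) := by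
          rw [hlog]
          field_simp
    · have hopt : (n : ℝ) ≤ 2 * minECSSSize 3 G := by
        have := card_le_minECSSSize_add_one three_ne_zero hG
        have h2 : n ≤ 2 * minECSSSize 3 G := by omega
        exact_mod_cast h2
      refine hle.trans ?_
      rw [hlog]
      calc 21 * (n : ℝ) ≤ 42 * minECSSSize 3 G := by linarith
        _ ≤ 42 * l * minECSSSize 3 G := by
          have : (0 : ℝ) ≤ minECSSSize 3 G := Nat.cast_nonneg _
          nlinarith
        _ = 42 / Real.log 2 * (l * Real.log 2) * minECSSSize 3 G := by
          field_simp
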